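/- \textbf{Theorem.} In the game of Cops and Robbers with $m$ cops on a finite graph $G$, first the cops are placed on vertices of $G$ (several cops may share a vertex), then the robber chooses a vertex; afterwards, in each round, first every cop and then the robber stays in place or moves to an adjacent vertex, with complete information. The cops win if, after finitely many rounds, some cop occupies the same vertex as the robber. The cop number $c(G)$ is the least $m$ such that $m$ cops have a winning strategy, and $G$ is \emph{$k$-cop-win} if $c(G)\le k$. For a vertex $v$ let $N^c(v)$ be the set of vertices different from $v$ and not adjacent to $v$; for a set $S$ of vertices let $N^c(S)=\bigcap_{u\in S}N^c(u)$; and let $\delta_k=\delta_k(G)=\min_{S\subseteq V(G),\,|S|=k}|N^c(S)|$. Let $G(n,1/2)$ be the random graph on $n$ labelled vertices in which each pair of vertices is joined with probability $1/2$, independently. Let $k\ge 1$ be an integer. There exist constants $\xi>0$ and $\varepsilon>0$ (depending only on $k$) such that, for all sufficiently large $n$, for $G$ drawn from $G(n,1/2)$: (a) $\mathbb{P}\bigl(G \text{ is } k\text{-cop-win and } 1\le\delta_k\le \xi n\bigr)\le 2^{(\log_2(1-2^{-k})-\varepsilon)n}$, and (b) $\mathbb{P}\bigl(G \text{ is } k\text{-cop-win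 and } \delta_k>\xi n\bigr)\le 2^{(\log_2(1-2^{-k})-\varepsilon)n}$. -/

import Mathlib

namespace CopsAndRobbers

variable {V : Type*}

/-- A legal move of a player in the graph `G`: the player passes or moves along an edge. -/
def Step (G : SimpleGraph V) (u w : V) : Prop :=
  w = u ∨ G.Adj u w

/-- A strategy for `k` cops on `G`. The cops see the whole game so far: `position h` is the
placement of the cops when `h` is the list of all positions that the robber has occupied so far
(in chronological order). In particular `position []` is the initial placement of the cops, which
is chosen before the robber chooses a starting vertex; several cops may share a vertex. Whenever
the robber has occupied a further vertex `r`, every cop passes or moves along an edge. -/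
structure CopStrategy (G : SimpleGraph V) (k : ℕ) where
  position : List V → Fin k → V
  legal : ∀ (h : List V) (r : V) (i : Fin k), Step G (position h i) (position (h ++ [r]) i)

/-- A route of the robber: the starting vertex `r 0`, and then one legal move in every round. -/
def IsRobberRoute (G : SimpleGraph V) (r : ℕ → V) : Prop :=
  ∀ t, Step G (r t) (r (t + 1))

/-- The positions of the cops after `t` moves, when they follow the strategy `σ` against
the robber route `r`; the `t`-th move is made with knowledge of `r 0, …, r (t - 1)` only. -/
def CopStrategy.copsAt {G : SimpleGraph V} {k : ℕ} (σ : CopStrategy G k) (r : ℕ → V) (t : ℕ) :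
    Fin k → V :=
  σ.position ((List.range t).map r)

/-- A cop strategy is winning if, against every route of the robber, after finitely many rounds
some cop occupies the vertex of the robber: either the robber occupies `r t` while a cop is there,
or a cop moves to `r t` while the robber is there. -/
def CopStrategy.IsWinning {G : SimpleGraph V} {k : ℕ} (σ : CopStrategy G k) : Prop :=
  ∀ r : ℕ → V, IsRobberRoute G r →
    ∃ t : ℕ, ∃ i : Fin k, σ.copsAt r t i = r t ∨ σ.copsAt r (t + 1) i = r t

/-- `k` cops have a winning strategy on `G`. -/
def CopsWin (G : SimpleGraph V) (k : ℕ) : Prop :=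
  ∃ σ : CopStrategy G k, σ.IsWinning

/-- The cop number `c(G)`: the minimum number of cops that have a winning strategy on `G`
(`⊤` if no finite number suffices, which cannot happen on a finite graph). -/
noncomputable def copNumber (G : SimpleGraph V) : ℕ∞ :=
  ⨅ m ∈ {m : ℕ | CopsWin G m}, (m : ℕ∞)

/-- `G` is `k`-cop-win if `c(G) ≤ k`. -/
def IsCopWin (G : SimpleGraph V) (k : ℕ) : Prop :=
  copNumber G ≤ k

/-- `N^c(v)`: the vertices different from `v` and not adjacent to `v`. -/
def nonNeighbors (G : SimpleGraph V) (v : V) : Set V :=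
  {w | w ≠ v ∧ ¬ G.Adj v w}

/-- `N^c(S)`: the intersection of the sets `N^c(u)`, `u ∈ S`, that is, the set of the vertices
that are not dominated by `S`. -/
def undominated (G : SimpleGraph V) (S : Finset V) : Set V :=
  ⋂ u ∈ S, nonNeighbors G u

/-- `δ_k(G)`: the minimum of `|N^c(S)|` over all sets `S` of exactly `k` vertices, for a finite
graph `G` with at least `k` vertices. -/
noncomputable def minUndominated (G : SimpleGraph V) (k : ℕ) : ℕ :=
  sInf {m : ℕ | ∃ S : Finset V, S.card = k ∧ (undominated G S).ncard = m}

/-- The law `G(n, 1/2)` on the labelled graphs with vertex set `{0, …, n - 1}`. -/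
noncomputable def randomGraph (n : ℕ) : MeasureTheory.Measure (SimpleGraph (Fin n)) :=
  SimpleGraph.binomialRandom (Fin n) ⟨1 / 2, Set.mem_Icc.2 ⟨by norm_num, by norm_num⟩⟩

end CopsAndRobbers

/-! A win for the cops forces a rare local configuration, a trap. Over a bounded set `W` containing
the trap, the traces on `W` of the outside vertices are independent and uniform, so the mean of a
product of weights is a power of one mean (`sum_prod_trace`). Markov's inequality bounds the
probability of each trap, and the union bound over traps costs only a polynomial factor.

If `δ_k > ξn`, no `k` vertices dominate the complement of a bounded set. The robber could live there
forever unless some `v` has all its neighbours there dominated by cops not standing on `v`. Deleting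
this trap and repeating gives `T` fresh traps (`exists_trapList`). Each has probability about
`2^(-ξn)`, so `T ≥ 2/ξ` traps cost about `4^(-n)`, which is small enough.

If `1 ≤ δ_k ≤ ξn`, a minimizing `S` dominates almost every vertex, which alone costs about `(1 -
2^(-k))^n`. The gain comes from `exists_trap_of_copsWin_of_undominated`: for some `v`, `w` and a
placement not covering `S`, the cops dominate the common neighbours of `v` and `w`. This forbids a
trace meeting `S`, hence a positive proportion of the traces still allowed. A small `ξ` keeps the
cost of the exceptional vertices below this gain. -/

open Finset

namespace CopsAndRobbers

/-! ### Independence of the traces, by averaging over edge flips -/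

section Averaging

variable {V : Type*}

open Classical in
/-- The neighbours of `u` in `W`. -/
noncomputable def trace (G : SimpleGraph V) (W : Finset V) (u : V) : Finset V :=
  W.filter fun w => G.Adj u w

lemma mem_trace {G : SimpleGraph V} {W : Finset V} {u w : V} :
    w ∈ trace G W u ↔ w ∈ W ∧ G.Adj u w := by
  classical
  simp [trace]

lemma trace_subset (G : SimpleGraph V) (W : Finset V) (u : V) : trace G W u ⊆ W :=
  fun _ h => (mem_trace.1 h).1

variable [DecidableEq V]

/-- The bipartite graph between `W` and its complement in which `u ∉ W` has the neighbourhood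
`A u`. -/
def crossGraph (W : Finset V) (A : {u // u ∉ W} → Finset V) : SimpleGraph V where
  Adj x y := (∃ u : {u // u ∉ W}, x = u ∧ y ∈ W ∧ y ∈ A u) ∨
    ∃ u : {u // u ∉ W}, y = u ∧ x ∈ W ∧ x ∈ A u
  symm := ⟨fun _ _ h => h.symm⟩
  loopless := ⟨by
    rintro x (⟨u, rfl, h, -⟩ | ⟨u, rfl, h, -⟩)
    · exact u.2 h
    · exact u.2 h⟩

lemma trace_symmDiff_crossGraph (G : SimpleGraph V) (W : Finset V)
    (A : {u // u ∉ W} → Finset V) (u : {u // u ∉ W}) (hA : A u ⊆ W) :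
    trace (symmDiff G (crossGraph W A)) W u = symmDiff (trace G W u) (A u) := by
  ext w
  have hc : w ∈ W → ((crossGraph W A).Adj u w ↔ w ∈ A u) := by
    intro hw
    constructor
    · rintro (⟨u', h, -, h'⟩ | ⟨u', h, -, -⟩)
      · rwa [Subtype.ext h]
      · exact absurd (h ▸ hw) u'.2
    · intro h
      exact Or.inl ⟨u, rfl, hw, h⟩
  rw [mem_trace, Finset.mem_symmDiff, mem_trace, symmDiff_def, SimpleGraph.sup_adj,
    SimpleGraph.sdiff_adj, SimpleGraph.sdiff_adj]
  by_cases hw : w ∈ W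
  · rw [hc hw]; tauto
  · have : w ∉ A u := fun h => hw (hA h)
    tauto

lemma sum_powerset_symmDiff (W x : Finset V) (hx : x ⊆ W) (g : Finset V → ℝ) :
    ∑ a ∈ W.powerset, g (symmDiff x a) = ∑ a ∈ W.powerset, g a := by
  refine Finset.sum_nbij' (fun a => symmDiff x a) (fun a => symmDiff x a) ?_ ?_ ?_ ?_ ?_
  · intro a ha
    rw [Finset.mem_powerset] at *
    exact symmDiff_le_sup.trans (Finset.union_subset hx ha)
  · intro a ha
    rw [Finset.mem_powerset] at *
    exact symmDiff_le_sup.trans (Finset.union_subset hx ha)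
  · intro a _
    exact symmDiff_symmDiff_cancel_left x a
  · intro a _
    exact symmDiff_symmDiff_cancel_left x a
  · intro a _
    rfl

variable [Fintype V]

/-- In a uniformly random graph, the neighbourhoods in `W` of the vertices outside `W` are
independent and uniformly distributed. -/
lemma sum_prod_trace (W : Finset V) (g : Finset V → ℝ) :
    ∑ G : SimpleGraph V, ∏ u ∈ Wᶜ, g (trace G W u) =
      Fintype.card (SimpleGraph V) * ((∑ x ∈ W.powerset, g x) / 2 ^ #W) ^ #Wᶜ := by
  classical
  have hprod : ∀ f : V → ℝ, ∏ u ∈ Wᶜ, f u = ∏ u : {u // u ∉ W}, f u := fun f =>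
    Finset.prod_subtype _ (by simp) f
  have hcard : Fintype.card {u // u ∉ W} = #Wᶜ := Fintype.card_of_subtype _ (by simp)
  set P := Fintype.piFinset fun _ : {u // u ∉ W} => W.powerset with hP
  have hPc : (#P : ℝ) = (2 ^ #W) ^ #Wᶜ := by
    rw [hP, Fintype.card_piFinset]
    simp [hcard]
  -- Flipping a fixed set of edges permutes all graphs. Averaging over `A` then randomizes every
  -- trace independently.
  have hflip : ∀ A : {u // u ∉ W} → Finset V,
      ∑ G : SimpleGraph V, ∏ u ∈ Wᶜ, g (trace (symmDiff G (crossGraph W A)) W u) =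
        ∑ G : SimpleGraph V, ∏ u ∈ Wᶜ, g (trace G W u) := fun A =>
    Equiv.sum_comp (Function.Involutive.toPerm (fun G => symmDiff G (crossGraph W A))
      fun G => symmDiff_symmDiff_cancel_right _ G) fun G => ∏ u ∈ Wᶜ, g (trace G W u)
  have key : (#P : ℝ) * ∑ G : SimpleGraph V, ∏ u ∈ Wᶜ, g (trace G W u) =
      Fintype.card (SimpleGraph V) * (∑ x ∈ W.powerset, g x) ^ #Wᶜ := by
    calc (#P : ℝ) * ∑ G : SimpleGraph V, ∏ u ∈ Wᶜ, g (trace G W u)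
        = ∑ A ∈ P, ∑ G : SimpleGraph V,
            ∏ u ∈ Wᶜ, g (trace (symmDiff G (crossGraph W A)) W u) := by
          rw [Finset.sum_congr rfl fun A _ => hflip A]
          simp
      _ = ∑ G : SimpleGraph V, ∑ A ∈ P,
            ∏ u : {u // u ∉ W}, g (symmDiff (trace G W u) (A u)) := by
          rw [Finset.sum_comm]
          refine Finset.sum_congr rfl fun G _ => Finset.sum_congr rfl fun A hA => ?_
          rw [hprod]
          refine Finset.prod_congr rfl fun u _ => ?_
          rw [trace_symmDiff_crossGraph]
          exact Finset.mem_powerset.1 (Fintype.mem_piFinset.1 hA u)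
      _ = ∑ G : SimpleGraph V, (∑ x ∈ W.powerset, g x) ^ #Wᶜ := by
          refine Finset.sum_congr rfl fun G _ => ?_
          rw [hP, ← Finset.prod_univ_sum (fun _ : {u // u ∉ W} => W.powerset)
            (fun u a => g (symmDiff (trace G W u) a))]
          rw [Finset.prod_congr rfl fun (u : {u // u ∉ W}) _ =>
            sum_powerset_symmDiff W _ (trace_subset G W u) g]
          simp [hcard]
      _ = _ := by simp
  rw [hPc] at key
  rw [div_pow, ← mul_div_assoc, eq_div_iff (by positivity), ← key, mul_comm]

end Averaging

/-! ### The uniform law, Markov's inequality and the union bound -/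

section Uniform

lemma randomGraph_real_singleton (n : ℕ) (G : SimpleGraph (Fin n)) :
    (randomGraph n).real {G} = (1 / 2) ^ (n.choose 2) := by
  classical
  have h : G.edgeSet.ncard ≤ n.choose 2 := by
    have := G.card_edgeFinset_le_card_choose_two
    rwa [Fintype.card_fin, SimpleGraph.edgeFinset, ← Set.ncard_eq_toFinset_card'] at this
  rw [MeasureTheory.measureReal_def, randomGraph, SimpleGraph.binomialRandom_singleton]
  rw [ENNReal.toReal_mul, ENNReal.toReal_pow, ENNReal.toReal_pow]
  have h1 : ∀ p : unitInterval, ((unitInterval.toNNReal p : ENNReal)).toReal = p := fun p => by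
    simp
  rw [h1, h1, unitInterval.coe_symm_eq, Nat.card_eq_fintype_card, Fintype.card_fin]
  rw [show (1 - ((⟨1 / 2, Set.mem_Icc.2 ⟨by norm_num, by norm_num⟩⟩ : unitInterval) : ℝ)) = 1 / 2 by
    norm_num]
  rw [← pow_add, Nat.add_sub_cancel' h]

instance (n : ℕ) : MeasureTheory.IsProbabilityMeasure (randomGraph n) := by
  unfold randomGraph
  infer_instance

instance (n : ℕ) : MeasurableSingletonClass (SimpleGraph (Fin n)) where
  measurableSet_singleton G := by
    have := SimpleGraph.measurableEmbedding_edgeSet (V := Fin n)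
    rw [← this.measurableSet_image, Set.image_singleton]
    exact MeasurableSet.singleton _

lemma randomGraph_real_eq (n : ℕ) (P : SimpleGraph (Fin n) → Prop) [DecidablePred P] :
    (randomGraph n).real {G | P G} = #(univ.filter P) / Fintype.card (SimpleGraph (Fin n)) := by
  have h : ∀ Q : Finset (SimpleGraph (Fin n)),
      (randomGraph n).real (Q : Set _) = #Q * (1 / 2) ^ (n.choose 2) := by
    intro Q
    rw [← MeasureTheory.sum_measureReal_singleton]
    rw [Finset.sum_congr rfl fun G _ => randomGraph_real_singleton n G]
    simp
  have h1 := h univ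
  rw [Finset.coe_univ, MeasureTheory.probReal_univ, Finset.card_univ] at h1
  have h2 := h (univ.filter P)
  rw [Finset.coe_filter_univ] at h2
  have h3 : (Fintype.card (SimpleGraph (Fin n)) : ℝ) ≠ 0 := by
    intro h; rw [h] at h1; simp at h1
  rw [h2, eq_div_iff h3, mul_assoc, mul_comm ((1 / 2 : ℝ) ^ _), ← h1, mul_one]

/-- Markov's inequality for a product of functions of the neighbourhoods in `W`. -/
lemma randomGraph_real_mul_le (n : ℕ) (P : SimpleGraph (Fin n) → Prop) (W : Finset (Fin n))
    (g : Finset (Fin n) → ℝ) (hg : ∀ x, 0 ≤ g x) (a : ℝ)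
    (h : ∀ G, P G → a ≤ ∏ u ∈ Wᶜ, g (trace G W u)) :
    (randomGraph n).real {G | P G} * a ≤ ((∑ x ∈ W.powerset, g x) / 2 ^ #W) ^ #Wᶜ := by
  classical
  have h1 := sum_prod_trace W g
  have h3 : (0 : ℝ) < Fintype.card (SimpleGraph (Fin n)) := by
    exact_mod_cast Fintype.card_pos
  have h2 : (#(univ.filter P) : ℝ) * a ≤
      ∑ G : SimpleGraph (Fin n), ∏ u ∈ Wᶜ, g (trace G W u) := by
    calc (#(univ.filter P) : ℝ) * a = ∑ G ∈ univ.filter P, a := by simp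
      _ ≤ ∑ G ∈ univ.filter P, ∏ u ∈ Wᶜ, g (trace G W u) :=
          Finset.sum_le_sum fun G hG => h G (Finset.mem_filter.1 hG).2
      _ ≤ _ := Finset.sum_le_sum_of_subset_of_nonneg (Finset.filter_subset _ _)
          fun G _ _ => Finset.prod_nonneg fun u _ => hg _
  rw [randomGraph_real_eq, div_mul_eq_mul_div, div_le_iff₀ h3, mul_comm _ (_ : ℝ)]
  rw [h1] at h2
  linarith

/-- The union bound. -/
lemma randomGraph_real_exists_le (n : ℕ) {ι : Type*} [Fintype ι]
    (P : SimpleGraph (Fin n) → Prop) (Q : ι → SimpleGraph (Fin n) → Prop) (b : ℝ)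
    (hPQ : ∀ G, P G → ∃ i, Q i G) (h : ∀ i, (randomGraph n).real {G | Q i G} ≤ b) :
    (randomGraph n).real {G | P G} ≤ Fintype.card ι * b := by
  calc (randomGraph n).real {G | P G} ≤ (randomGraph n).real (⋃ i, {G | Q i G}) := by
        refine MeasureTheory.measureReal_mono fun G hG => ?_
        simpa using hPQ G hG
    _ ≤ ∑ i, (randomGraph n).real {G | Q i G} := MeasureTheory.measureReal_iUnion_fintype_le _
    _ ≤ ∑ _i : ι, b := Finset.sum_le_sum fun i _ => h i
    _ = _ := by simp

end Uniform

/-! ### Evasion strategies for the robber -/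

section Game

variable {V : Type*} {G : SimpleGraph V}

lemma Step.symm {u w : V} (h : Step G u w) : Step G w u :=
  h.elim (fun h => Or.inl h.symm) fun h => Or.inr h.symm

/-- The robber escapes if he has an invariant that he can establish and preserve. -/
lemma not_copsWin_of_invariant {m : ℕ} (Safe : V → (Fin m → V) → Prop)
    (hsafe : ∀ v C, Safe v C → ∀ i, ¬ Step G (C i) v)
    (hstart : ∀ C, ∃ v, Safe v C)
    (hmove : ∀ v C C', Safe v C → (∀ i, Step G (C i) (C' i)) → ∃ u, Step G v u ∧ Safe u C') :
    ¬ CopsWin G m := by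
  rintro ⟨σ, hσ⟩
  -- A state is the robber's past together with his current vertex, which the cops have not yet
  -- answered.
  let State := {p : List V × V // Safe p.2 (σ.position p.1)}
  have hnext : ∀ p : State, ∃ q : State, q.1.1 = p.1.1 ++ [p.1.2] ∧ Step G p.1.2 q.1.2 := by
    rintro ⟨⟨l, v⟩, h⟩
    obtain ⟨u, hu, hs⟩ := hmove v _ (σ.position (l ++ [v])) h (σ.legal l v)
    exact ⟨⟨(l ++ [v], u), hs⟩, rfl, hu⟩
  choose next hnext using hnext
  obtain ⟨v₀, hv₀⟩ := hstart (σ.position [])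
  let p : ℕ → State := fun t => Nat.rec ⟨([], v₀), hv₀⟩ (fun _ => next) t
  have hp : ∀ t, p (t + 1) = next (p t) := fun _ => rfl
  let r : ℕ → V := fun t => (p t).1.2
  have hh : ∀ t, (p t).1.1 = (List.range t).map r := by
    intro t
    induction t with
    | zero => rfl
    | succ t ih =>
      rw [hp, (hnext _).1, ih, List.range_succ, List.map_append]
      rfl
  have hs : ∀ t i, ¬ Step G (σ.copsAt r t i) (r t) := by
    intro t
    have := hsafe _ _ (p t).2
    rw [hh] at this
    exact this
  obtain ⟨t, i, h | h⟩ := hσ r fun t => by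
    have := (hnext (p t)).2
    rw [← hp] at this
    exact this
  · exact hs t i (Or.inl h.symm)
  · apply hs t i
    rw [← h]
    have := σ.legal ((List.range t).map r) (r t) i
    rw [CopStrategy.copsAt, CopStrategy.copsAt, List.range_succ, List.map_append]
    exact this

lemma not_copsWin_zero [Nonempty V] : ¬ CopsWin G 0 :=
  not_copsWin_of_invariant (fun _ _ => True) (fun _ _ _ i => i.elim0)
    (fun _ => ⟨Classical.arbitrary V, trivial⟩) fun v _ _ _ _ => ⟨v, Or.inl rfl, trivial⟩

lemma CopsWin.mono {m k : ℕ} (hm : 0 < m) (hmk : m ≤ k) (h : CopsWin G m) : CopsWin G k := by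
  obtain ⟨σ, hσ⟩ := h
  -- Surplus cops imitate the last one, so at least one is needed.
  let f : Fin k → Fin m := fun i => ⟨min i (m - 1), by omega⟩
  refine ⟨⟨fun l i => σ.position l (f i), fun l r i => σ.legal l r (f i)⟩, fun r hr => ?_⟩
  obtain ⟨t, i, h⟩ := hσ r hr
  have hi : f ⟨i, by omega⟩ = i := by
    ext
    simp only [f]
    omega
  refine ⟨t, ⟨i, by omega⟩, ?_⟩
  simpa only [CopStrategy.copsAt, hi] using h

lemma IsCopWin.copsWin [Nonempty V] {k : ℕ} (h : IsCopWin G k) : CopsWin G k := by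
  by_contra hk
  have : ((k + 1 : ℕ) : ℕ∞) ≤ copNumber G := by
    refine le_iInf₂ fun m hm => ?_
    rw [Nat.cast_le]
    by_contra hmk
    rcases Nat.eq_zero_or_pos m with rfl | h0
    · exact not_copsWin_zero hm
    · exact hk (CopsWin.mono h0 (by omega) hm)
  have := this.trans h
  rw [Nat.cast_le] at this
  omega

lemma mem_undominated {S : Finset V} {u : V} :
    u ∈ undominated G S ↔ ∀ s ∈ S, ¬ Step G s u := by
  simp [undominated, nonNeighbors, Step]

/-- If the robber can always stay in `R`, then he escapes. -/
lemma exists_trap_of_copsWin {k : ℕ} (R : Set V) (h : CopsWin G k)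
    (hR : ∀ C : Fin k → V, ∃ v ∈ R, ∀ i, ¬ Step G (C i) v) :
    ∃ v ∈ R, ∃ C : Fin k → V, (∀ i, C i ≠ v) ∧
      ∀ u ∈ R, Step G v u → ∃ i, Step G (C i) u := by
  by_contra! hcon
  refine not_copsWin_of_invariant (fun v C => v ∈ R ∧ ∀ i, ¬ Step G (C i) v)
    (fun v C h => h.2) hR ?_ h
  rintro v C C' ⟨hv, hC⟩ hC'
  obtain ⟨u, hu, hvu, hs⟩ := hcon v hv C' fun i hi => hC i (hi ▸ hC' i)
  exact ⟨u, hvu, hu, hs⟩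

/-- If `S` does not dominate `G`, the robber can stay close to the undominated vertices whenever
the cops threaten to occupy `S`. -/
lemma exists_trap_of_copsWin_of_undominated [DecidableEq V] {k : ℕ} (h : CopsWin G k)
    (S : Finset V) (hS : #S = k) (hD : (undominated G S).Nonempty)
    (hV : ∀ C : Fin k → V, ∃ v, ∀ i, C i ≠ v) :
    ∃ v w, ∃ C : Fin k → V, ¬ S ⊆ univ.image C ∧ (∀ i, C i ≠ v) ∧ (∀ i, C i ≠ w) ∧
      ∀ u, G.Adj v u → G.Adj w u → ∃ i, Step G (C i) u := by
  by_contra! hcon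
  -- The assumed common neighbours fail only when the cops cover `S`. The robber prepares for this
  -- one move ahead, staying within a step of an undominated vertex.
  let Threat (C : Fin k → V) : Prop := ∃ C', (∀ i, Step G (C i) (C' i)) ∧ univ.image C' = S
  have hthreat : ∀ (C : Fin k → V) i, C i ∈ undominated G S → ¬ Threat C := by
    rintro C i hi ⟨C', hC', rfl⟩
    exact mem_undominated.1 hi (C' i) (by simp) (hC' i).symm
  have hsub : ∀ C : Fin k → V, univ.image C ≠ S → ¬ S ⊆ univ.image C := by
    intro C hC hSC
    refine hC (Finset.eq_of_subset_of_card_le hSC ?_).symm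
    rw [hS]
    exact Finset.card_image_le.trans (by simp)
  let Safe (v : V) (C : Fin k → V) : Prop := (∀ i, ¬ Step G (C i) v) ∧
    (Threat C → ∃ w ∈ undominated G S, Step G v w)
  have hon : ∀ (C : Fin k → V) w, univ.image C = S → w ∈ undominated G S → Safe w C := by
    rintro C w rfl hw
    exact ⟨fun i => mem_undominated.1 hw (C i) (by simp), fun _ => ⟨w, hw, Or.inl rfl⟩⟩
  have hoff : ∀ (C : Fin k → V) v, univ.image C ≠ S → (∀ i, C i ≠ v) →
      ∃ u, G.Adj v u ∧ Safe u C := by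
    intro C v hC hv
    -- A cop on an undominated vertex cannot reach `S` in one move, so there is no threat and `w =
    -- v` suffices. Otherwise an undominated `w` is free of cops, and a common neighbour of `v` and
    -- `w` is prepared for the threat.
    by_cases hCD : ∃ i, C i ∈ undominated G S
    · obtain ⟨i, hi⟩ := hCD
      obtain ⟨u, hu, -, hs⟩ := hcon v v C (hsub C hC) hv hv
      exact ⟨u, hu, hs, fun ht => absurd ht (hthreat C i hi)⟩
    · push Not at hCD
      obtain ⟨w, hw⟩ := hD
      obtain ⟨u, hu, hwu, hs⟩ := hcon v w C (hsub C hC) hv fun i hi => hCD i (hi ▸ hw)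
      exact ⟨u, hu, hs, fun _ => ⟨w, hw, Or.inr hwu.symm⟩⟩
  refine not_copsWin_of_invariant Safe (fun v C h => h.1) ?_ ?_ h
  · intro C
    by_cases hC : univ.image C = S
    · obtain ⟨w, hw⟩ := hD
      exact ⟨w, hon C w hC hw⟩
    · obtain ⟨v, hv⟩ := hV C
      obtain ⟨u, -, hu⟩ := hoff C v hC hv
      exact ⟨u, hu⟩
  · rintro v C C' ⟨hv, ht⟩ hC'
    by_cases hC : univ.image C' = S
    · obtain ⟨w, hw, hvw⟩ := ht ⟨C', hC', hC⟩
      exact ⟨w, hvw, hon C' w hC hw⟩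
    · obtain ⟨u, hu, hs⟩ := hoff C' v hC fun i hi => hv i (hi ▸ hC' i)
      exact ⟨u, Or.inr hu, hs⟩

end Game

/-! ### Successive disjointly chosen traps -/

section TrapList

variable {V : Type*} [DecidableEq V] {k : ℕ}

/-- The vertices that occur in a list of pairs of a vertex and a placement of the cops. -/
def support : List (V × (Fin k → V)) → Finset V
  | [] => ∅
  | p :: l => insert p.1 (univ.image p.2) ∪ support l

/-- In the list, each vertex is new and not occupied by its cops. -/
def IsFresh : List (V × (Fin k → V)) → Prop
  | [] => True
  | p :: l => (∀ i, p.2 i ≠ p.1) ∧ p.1 ∉ support l ∧ IsFresh l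

lemma card_support_le (l : List (V × (Fin k → V))) : #(support l) ≤ (k + 1) * l.length := by
  induction l with
  | nil => simp [support]
  | cons p l ih =>
    rw [support, List.length_cons, mul_add, mul_one, add_comm]
    refine (Finset.card_union_le _ _).trans (add_le_add ((Finset.card_insert_le _ _).trans ?_) ih)
    have : #(univ.image p.2) ≤ k := Finset.card_image_le.trans (by simp)
    omega

lemma mem_support_of_mem {l : List (V × (Fin k → V))} {p : V × (Fin k → V)} (hp : p ∈ l) :
    p.1 ∈ support l ∧ ∀ i, p.2 i ∈ support l := by
  induction l with
  | nil => simp at hp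
  | cons q l ih =>
    rw [List.mem_cons] at hp
    rcases hp with rfl | hp
    · simp [support]
    · have := ih hp
      simp [support, this]

/-- Each new trap arises from confining the robber to the complement of the support so far. Outside
the final support no cop of the list stands on `u`, so domination becomes adjacency. -/
lemma exists_trapList {G : SimpleGraph V} (h : CopsWin G k) (T : ℕ)
    (hT : ∀ X : Finset V, #X ≤ (k + 1) * T →
      ∀ C : Fin k → V, ∃ v ∉ X, ∀ i, ¬ Step G (C i) v) :
    ∃ l : List (V × (Fin k → V)), l.length = T ∧ IsFresh l ∧
      ∀ p ∈ l, ∀ u ∉ support l, G.Adj p.1 u → ∃ i, G.Adj (p.2 i) u := by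
  induction T with
  | zero => exact ⟨[], rfl, trivial, by simp⟩
  | succ T ih =>
    obtain ⟨l, hl, hf, ht⟩ := ih fun X hX => hT X (hX.trans (Nat.mul_le_mul_left _ T.le_succ))
    have hc : #(support l) ≤ (k + 1) * (T + 1) := by
      refine (card_support_le l).trans (Nat.mul_le_mul_left _ ?_)
      omega
    obtain ⟨v, hv, C, hvC, htrap⟩ := exists_trap_of_copsWin ((support l : Set V)ᶜ) h fun C => by
      simpa using hT _ hc C
    refine ⟨(v, C) :: l, by simp [hl], ⟨hvC, by simpa using hv, hf⟩, ?_⟩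
    intro p hp u hu hpu
    have hul : u ∉ support l := fun h' => hu (by simp [support, h'])
    rw [List.mem_cons] at hp
    rcases hp with rfl | hp
    · obtain ⟨i, hi⟩ := htrap u (by simpa using hul) (Or.inr hpu)
      refine ⟨i, hi.resolve_left ?_⟩
      rintro rfl
      exact hu (by simp [support])
    · exact ht p hp u hul hpu

end TrapList

/-! ### Probability of a list of traps -/

section TrapListBound

variable {V : Type*} [DecidableEq V] {k : ℕ}

open Classical in
/-- A weight that vanishes if `x` contains `p.1` but no vertex occupied by the cops, and rewards
that `x` contains none of these. -/
noncomputable def trapWeight (p : V × (Fin k → V)) (x : Finset V) : ℝ :=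
  if ∀ i, p.2 i ∉ x then (if p.1 ∈ x then 0 else 2) else 1

lemma trapWeight_nonneg (p : V × (Fin k → V)) (x : Finset V) : 0 ≤ trapWeight p x := by
  unfold trapWeight
  split_ifs <;> norm_num

lemma trapWeight_symmDiff_of_ne {p : V × (Fin k → V)} {v : V} (h₁ : v ≠ p.1)
    (h₂ : ∀ i, p.2 i ≠ v) (x : Finset V) :
    trapWeight p (symmDiff {v} x) = trapWeight p x := by
  have h : ∀ w, w ≠ v → (w ∈ symmDiff {v} x ↔ w ∈ x) := fun w hw => by
    simp [Finset.mem_symmDiff, hw]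
  simp only [trapWeight, h _ h₁.symm, h _ (h₂ _)]

/-- Toggling `p.1` swaps the values 0 and 2 and fixes the value 1, so the weight has mean 1. -/
lemma trapWeight_symmDiff_add {p : V × (Fin k → V)} (h : ∀ i, p.2 i ≠ p.1) (x : Finset V) :
    trapWeight p (symmDiff {p.1} x) + trapWeight p x = 2 := by
  have h' : ∀ w, w ≠ p.1 → (w ∈ symmDiff {p.1} x ↔ w ∈ x) := fun w hw => by
    simp [Finset.mem_symmDiff, hw]
  have h'' : p.1 ∈ symmDiff {p.1} x ↔ p.1 ∉ x := by
    simp [Finset.mem_symmDiff]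
  simp only [trapWeight, h' _ (h _), h'']
  split_ifs <;> norm_num

/-- The head vertex is absent from the support of the tail. Toggling it averages the head weight to
1 without changing the others, so traps sharing cops still multiply. -/
lemma sum_trapWeight_prod (W : Finset V) (l : List (V × (Fin k → V))) (hl : IsFresh l)
    (hW : support l ⊆ W) :
    ∑ x ∈ W.powerset, (l.map fun p => trapWeight p x).prod = 2 ^ #W := by
  induction l with
  | nil => simp
  | cons p l ih =>
    obtain ⟨hp, hpl, hl⟩ := hl
    rw [support, Finset.union_subset_iff] at hW
    specialize ih hl hW.2
    have hpW : {p.1} ⊆ W := by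
      rw [Finset.singleton_subset_iff]
      exact hW.1 (by simp)
    have hinv : ∀ x : Finset V, (l.map fun q => trapWeight q (symmDiff {p.1} x)).prod =
        (l.map fun q => trapWeight q x).prod := by
      intro x
      congr 1
      refine List.map_congr_left fun q hq => trapWeight_symmDiff_of_ne ?_ ?_ x
      · intro h
        exact hpl (h ▸ (mem_support_of_mem hq).1)
      · intro i h
        exact hpl (h ▸ (mem_support_of_mem hq).2 i)
    have h1 := sum_powerset_symmDiff W {p.1} hpW
      fun x => trapWeight p x * (l.map fun q => trapWeight q x).prod
    have h2 : ∑ x ∈ W.powerset, trapWeight p (symmDiff {p.1} x) *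
          (l.map fun q => trapWeight q (symmDiff {p.1} x)).prod +
        ∑ x ∈ W.powerset, trapWeight p x * (l.map fun q => trapWeight q x).prod =
        2 * ∑ x ∈ W.powerset, (l.map fun q => trapWeight q x).prod := by
      rw [← Finset.sum_add_distrib, Finset.mul_sum]
      refine Finset.sum_congr rfl fun x _ => ?_
      rw [hinv, ← add_mul, trapWeight_symmDiff_add hp]
    simp only [List.map_cons, List.prod_cons]
    linarith

open Classical in
lemma le_prod_trapWeight {ι : Type*} (U : Finset ι) (x : ι → Finset V) (s : ℕ)
    (l : List (V × (Fin k → V))) (h₁ : ∀ p ∈ l, ∀ u ∈ U, p.1 ∈ x u → ∃ i, p.2 i ∈ x u)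
    (h₂ : ∀ p ∈ l, s ≤ #{u ∈ U | ∀ i, p.2 i ∉ x u}) :
    ((2 : ℝ) ^ s) ^ l.length ≤ ∏ u ∈ U, (l.map fun p => trapWeight p (x u)).prod := by
  induction l with
  | nil => simp
  | cons p l ih =>
    specialize ih (fun q hq => h₁ q (List.mem_cons_of_mem _ hq))
      fun q hq => h₂ q (List.mem_cons_of_mem _ hq)
    simp only [List.map_cons, List.prod_cons, List.length_cons]
    rw [Finset.prod_mul_distrib, pow_succ']
    have hp : ∀ u ∈ U, trapWeight p (x u) = if ∀ i, p.2 i ∉ x u then 2 else 1 := by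
      intro u hu
      unfold trapWeight
      split_ifs with h h'
      · obtain ⟨i, hi⟩ := h₁ p List.mem_cons_self u hu h'
        exact absurd hi (h i)
      · rfl
      · rfl
    rw [Finset.prod_congr rfl hp]
    refine mul_le_mul ?_ ih (by positivity) (Finset.prod_nonneg fun u _ => by split_ifs <;> norm_num)
    rw [Finset.prod_ite, Finset.prod_const, Finset.prod_const_one, mul_one]
    exact pow_le_pow_right₀ (by norm_num) (h₂ p List.mem_cons_self)

-- The product of weights has mean 1, but each trap contributes a factor 2 for at least `s` outside
-- vertices.
open Classical in
lemma randomGraph_real_trapList_le {n : ℕ} (l : List (Fin n × (Fin k → Fin n))) (hl : IsFresh l)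
    (s : ℕ) :
    (randomGraph n).real {G | (∀ p ∈ l, ∀ u ∉ support l, G.Adj p.1 u → ∃ i, G.Adj (p.2 i) u) ∧
      ∀ p ∈ l, s ≤ #{u ∈ (support l)ᶜ | ∀ i, ¬ G.Adj (p.2 i) u}} ≤ (1 / 2) ^ (s * l.length) := by
  have h := randomGraph_real_mul_le n (fun G =>
      (∀ p ∈ l, ∀ u ∉ support l, G.Adj p.1 u → ∃ i, G.Adj (p.2 i) u) ∧
      ∀ p ∈ l, s ≤ #{u ∈ (support l)ᶜ | ∀ i, ¬ G.Adj (p.2 i) u}) (support l)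
    (fun x => (l.map fun p => trapWeight p x).prod)
    (fun x => List.prod_nonneg fun a ha => by
      obtain ⟨p, -, rfl⟩ := List.mem_map.1 ha
      exact trapWeight_nonneg p x) ((2 ^ s) ^ l.length) (by
      rintro G ⟨h1, h2⟩
      have hmem : ∀ p ∈ l, ∀ u, ∀ i, p.2 i ∈ trace G (support l) u ↔ G.Adj (p.2 i) u := by
        intro p hp u i
        rw [mem_trace, G.adj_comm]
        simp [(mem_support_of_mem hp).2 i]
      refine le_prod_trapWeight _ _ _ _ ?_ ?_
      · intro p hp u hu hpu
        obtain ⟨i, hi⟩ := h1 p hp u (Finset.mem_compl.1 hu) (mem_trace.1 hpu).2.symm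
        exact ⟨i, (hmem p hp u i).2 hi⟩
      · intro p hp
        simpa only [hmem p hp] using h2 p hp)
  rw [sum_trapWeight_prod _ _ hl subset_rfl, div_self (by positivity), one_pow, ← pow_mul] at h
  rw [one_div, inv_pow, ← one_div, le_div_iff₀ (by positivity)]
  exact h

end TrapListBound

/-! ### Near domination combined with one trap -/

section NearlyDominating

-- Weight 0 excludes traces violating the trap, and weight `c` penalizes vertices missed by `S`.
-- Relative to domination by `S`, the mean gains at least `2 ^ (-#W) ≥ 2 * c` from one excluded
-- trace and loses at most `c` from the missed vertices.
open Classical in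
lemma randomGraph_real_nearlyDominating_le {n k : ℕ} (S : Finset (Fin n)) (hS : #S = k)
    (C : Fin k → Fin n) (v w : Fin n) (hSC : ¬ S ⊆ univ.image C) (hv : ∀ i, C i ≠ v)
    (hw : ∀ i, C i ≠ w) (s : ℕ) :
    (randomGraph n).real {G | #{u ∈ (S ∪ univ.image C ∪ {v, w})ᶜ | ∀ a ∈ S, ¬ G.Adj a u} ≤ s ∧
        ∀ u ∈ (S ∪ univ.image C ∪ {v, w})ᶜ, G.Adj v u → G.Adj w u → ∃ i, G.Adj (C i) u} *
      ((1 / 2) ^ (2 * k + 3)) ^ s ≤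
      (1 - (1 / 2) ^ k - (1 / 2) ^ (2 * k + 3)) ^ #(S ∪ univ.image C ∪ {v, w})ᶜ := by
  set W := S ∪ univ.image C ∪ {v, w} with hW
  set c : ℝ := (1 / 2) ^ (2 * k + 3) with hc
  have hc0 : 0 < c := by positivity
  have hc1 : c ≤ 1 := pow_le_one₀ (by norm_num) (by norm_num)
  have hSW : S ⊆ W := fun x hx => by simp [hW, hx]
  have hCW : ∀ i, C i ∈ W := fun i => by simp [hW]
  have hvW : v ∈ W := by simp [hW]
  have hwW : w ∈ W := by simp [hW]
  have hWc : #W ≤ 2 * k + 2 := by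
    have h1 : #(univ.image C) ≤ k := Finset.card_image_le.trans (by simp)
    have h2 : #({v, w} : Finset (Fin n)) ≤ 2 := Finset.card_le_two
    have h3 := Finset.card_union_le (S ∪ univ.image C) {v, w}
    have h4 := Finset.card_union_le S (univ.image C)
    rw [hW]
    omega
  let g : Finset (Fin n) → ℝ := fun x =>
    if v ∈ x ∧ w ∈ x ∧ ∀ i, C i ∉ x then 0 else if ∀ a ∈ S, a ∉ x then c else 1
  have hg : ∀ x, 0 ≤ g x := fun x => by
    simp only [g]
    split_ifs <;> linarith
  have h := randomGraph_real_mul_le n (fun G => #{u ∈ Wᶜ | ∀ a ∈ S, ¬ G.Adj a u} ≤ s ∧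
        ∀ u ∈ Wᶜ, G.Adj v u → G.Adj w u → ∃ i, G.Adj (C i) u) W g hg (c ^ s) (by
      rintro G ⟨h1, h2⟩
      have hmem : ∀ a ∈ W, ∀ u, a ∈ trace G W u ↔ G.Adj a u := by
        intro a ha u
        rw [mem_trace, G.adj_comm]
        simp [ha]
      have hgu : ∀ u ∈ Wᶜ, g (trace G W u) = if ∀ a ∈ S, ¬ G.Adj a u then c else 1 := by
        intro u hu
        simp only [g]
        rw [if_neg]
        · congr 1
          exact propext (forall₂_congr fun a ha => not_congr (hmem a (hSW ha) u))
        · rintro ⟨h3, h4, h5⟩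
          obtain ⟨i, hi⟩ := h2 u hu ((hmem v hvW u).1 h3) ((hmem w hwW u).1 h4)
          exact h5 i ((hmem _ (hCW i) u).2 hi)
      rw [Finset.prod_congr rfl hgu, Finset.prod_ite, Finset.prod_const, Finset.prod_const_one,
        mul_one]
      exact pow_le_pow_of_le_one hc0.le hc1 h1)
  refine h.trans (pow_le_pow_left₀
    (div_nonneg (Finset.sum_nonneg fun x _ => hg x) (by positivity)) ?_ _)
  -- The trace `W \ univ.image C` violates the trap and meets `S`, so the two subtracted terms never
  -- apply together.
  have hbound : ∀ x ∈ W.powerset, g x ≤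
      1 - (if x ∈ (W \ S).powerset then 1 - c else 0) - (if x = W \ univ.image C then 1 else 0) := by
    intro x hx
    rw [Finset.mem_powerset] at hx
    have hdisj : x ∈ (W \ S).powerset ↔ ∀ a ∈ S, a ∉ x := by
      rw [Finset.mem_powerset]
      constructor
      · intro h a ha hax
        exact (Finset.mem_sdiff.1 (h hax)).2 ha
      · intro h a ha
        exact Finset.mem_sdiff.2 ⟨hx ha, fun haS => h a haS ha⟩
    simp only [hdisj]
    by_cases hxC : x = W \ univ.image C
    · have h1 : v ∈ x ∧ w ∈ x ∧ ∀ i, C i ∉ x := by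
        subst hxC
        simp [hvW, hwW, hv, hw]
      have h2 : ¬ ∀ a ∈ S, a ∉ x := by
        obtain ⟨a, ha, haC⟩ := Finset.not_subset.1 hSC
        intro h
        apply h a ha
        rw [hxC]
        exact Finset.mem_sdiff.2 ⟨hSW ha, haC⟩
      simp only [g]
      rw [if_pos h1, if_neg h2, if_pos hxC]
      norm_num
    · simp only [g]
      rw [if_neg hxC]
      split_ifs <;> linarith
  have hsum : ∑ x ∈ W.powerset, g x ≤ 2 ^ #W - (1 - c) * 2 ^ (#W - k) - 1 := by
    refine (Finset.sum_le_sum hbound).trans_eq ?_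
    have hsub : (W \ S).powerset ⊆ W.powerset :=
      Finset.powerset_mono.2 Finset.sdiff_subset
    rw [Finset.sum_sub_distrib, Finset.sum_sub_distrib, Finset.sum_ite_mem,
      Finset.inter_eq_right.2 hsub, Finset.sum_ite_eq', if_pos (by simp)]
    simp [Finset.card_sdiff_of_subset hSW, hS]
    ring
  have hkW : k ≤ #W := hS ▸ Finset.card_le_card hSW
  have h2W : (2 : ℝ) ^ #W = 2 ^ (#W - k) * 2 ^ k := by
    rw [← pow_add, Nat.sub_add_cancel hkW]
  have hcW : 2 * c * 2 ^ #W ≤ 1 := by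
    calc 2 * c * 2 ^ #W ≤ 2 * c * 2 ^ (2 * k + 2) := by
          gcongr
          norm_num
      _ = 1 := by
          rw [hc, one_div, inv_pow, pow_succ (2 : ℝ) (2 * k + 2)]
          field_simp
  rw [div_le_iff₀ (by positivity)]
  have h3 : ((1 : ℝ) / 2) ^ k * 2 ^ #W = 2 ^ (#W - k) := by
    rw [h2W, one_div, inv_pow]
    field_simp
  have h4 : (2 : ℝ) ^ (#W - k) ≤ 2 ^ #W := pow_le_pow_right₀ (by norm_num) (Nat.sub_le _ _)
  have h5 : c * (2 : ℝ) ^ (#W - k) ≤ c * 2 ^ #W := mul_le_mul_of_nonneg_left h4 hc0.le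
  rw [sub_mul, sub_mul, h3]
  linarith

end NearlyDominating

/-! ### Sets attaining or bounding `δ_k` -/

section Undominated

variable {n k : ℕ} {G : SimpleGraph (Fin n)}

lemma minUndominated_le {S : Finset (Fin n)} (hS : #S = k) :
    minUndominated G k ≤ (undominated G S).ncard :=
  Nat.sInf_le ⟨S, hS, rfl⟩

lemma minUndominated_le_image (hn : k ≤ n) (C : Fin k → Fin n) :
    minUndominated G k ≤ (undominated G (univ.image C)).ncard := by
  have hC : #(univ.image C) ≤ k := Finset.card_image_le.trans (by simp)
  -- Cops may coincide; enlarging their set to `k` vertices only shrinks the undominated set.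
  obtain ⟨S, hCS, -, hS⟩ := Finset.exists_subsuperset_card_eq
    (Finset.subset_univ (univ.image C)) hC (by simpa using hn)
  refine (minUndominated_le hS).trans (Set.ncard_le_ncard ?_ (Set.toFinite _))
  intro u hu
  rw [mem_undominated] at *
  exact fun s hs => hu s (hCS hs)

lemma exists_ncard_undominated_eq (hn : k ≤ n) :
    ∃ S : Finset (Fin n), #S = k ∧ (undominated G S).ncard = minUndominated G k := by
  obtain ⟨S, -, hS⟩ := Finset.exists_subset_card_eq (s := (univ : Finset (Fin n))) (by simpa using hn)
  exact Nat.sInf_mem (s := {m : ℕ | ∃ S : Finset (Fin n), S.card = k ∧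
    (undominated G S).ncard = m}) ⟨_, S, hS, rfl⟩

end Undominated

/-! ### Union bounds for the two ranges of `δ_k` -/

section Bounds

variable {n k : ℕ}

lemma randomGraph_real_undominated_ge_le (hn : 0 < n) (hkn : k ≤ n) (T s : ℕ) (hs : 0 < s) :
    (randomGraph n).real {G | IsCopWin G k ∧ s + (k + 1) * T ≤ minUndominated G k} ≤
      (n ^ (k + 1) : ℝ) ^ T * (1 / 2) ^ (s * T) := by
  classical
  have : NeZero n := ⟨hn.ne'⟩
  have hcard : (Fintype.card (List.Vector (Fin n × (Fin k → Fin n)) T) : ℝ) =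
      (n ^ (k + 1) : ℝ) ^ T := by
    simp [card_vector, pow_succ']
  rw [← hcard]
  refine randomGraph_real_exists_le n _ (fun (l : List.Vector (Fin n × (Fin k → Fin n)) T) G =>
    IsFresh l.1 ∧ (∀ p ∈ l.1, ∀ u ∉ support l.1, G.Adj p.1 u → ∃ i, G.Adj (p.2 i) u) ∧
      ∀ p ∈ l.1, s ≤ #{u ∈ (support l.1)ᶜ | ∀ i, ¬ G.Adj (p.2 i) u}) _ ?_ ?_
  · rintro G ⟨hG, hmin⟩
    -- The term `(k + 1) * T` pays for deleting the support of the list.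
    have hlarge : ∀ X : Finset (Fin n), #X ≤ (k + 1) * T → ∀ C : Fin k → Fin n,
        s ≤ #{u ∈ Xᶜ | ∀ i, ¬ Step G (C i) u} := by
      intro X hX C
      have h1 := hmin.trans (minUndominated_le_image hkn C)
      have h2 : undominated G (univ.image C) ⊆
          (({u ∈ Xᶜ | ∀ i, ¬ Step G (C i) u} ∪ X : Finset (Fin n)) : Set (Fin n)) := by
        intro u hu
        rw [mem_undominated] at hu
        by_cases huX : u ∈ X
        · simp [huX]
        · simpa [huX] using hu
      have h3 := Set.ncard_le_ncard h2 (Set.toFinite _)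
      rw [Set.ncard_coe_finset] at h3
      have h4 := Finset.card_union_le {u ∈ Xᶜ | ∀ i, ¬ Step G (C i) u} X
      omega
    obtain ⟨l, hl, hf, ht⟩ := exists_trapList hG.copsWin T fun X hX C => by
      obtain ⟨u, hu⟩ := Finset.card_pos.1 (hs.trans_le (hlarge X hX C))
      simp only [Finset.mem_filter, Finset.mem_compl] at hu
      exact ⟨u, hu⟩
    refine ⟨⟨l, hl⟩, hf, ht, fun p _ => ?_⟩
    refine (hlarge (support l) (hl ▸ card_support_le l) p.2).trans (Finset.card_le_card ?_)
    intro u hu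
    rw [Finset.mem_filter] at *
    exact ⟨hu.1, fun i hi => hu.2 i (Or.inr hi)⟩
  · intro l
    by_cases hf : IsFresh l.1
    · have := randomGraph_real_trapList_le l.1 hf s
      rw [l.2] at this
      simpa only [hf, true_and] using this
    · simp only [hf, false_and, Set.ofPred_false, MeasureTheory.measureReal_empty]
      positivity

lemma one_sub_pow_pos (hk : 1 ≤ k) :
    (1 : ℝ) / 4 < 1 - (1 / 2) ^ k - (1 / 2) ^ (2 * k + 3) := by
  have h1 : ((1 : ℝ) / 2) ^ k ≤ (1 / 2) ^ 1 := pow_le_pow_of_le_one (by norm_num) (by norm_num) hk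
  have h2 : ((1 : ℝ) / 2) ^ (2 * k + 3) ≤ (1 / 2) ^ 3 :=
    pow_le_pow_of_le_one (by norm_num) (by norm_num) (by omega)
  norm_num at h1 h2 ⊢
  linarith

lemma randomGraph_real_undominated_le_le (hk : 1 ≤ k) (hkn : k < n) (s : ℕ) :
    (randomGraph n).real {G | IsCopWin G k ∧ 1 ≤ minUndominated G k ∧ minUndominated G k ≤ s} *
      ((1 / 2) ^ (2 * k + 3)) ^ s ≤
      (n : ℝ) ^ (2 * k + 2) * (1 - (1 / 2) ^ k - (1 / 2) ^ (2 * k + 3)) ^ (n - (2 * k + 2)) := by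
  classical
  have : NeZero n := ⟨by omega⟩
  set a : ℝ := 1 - (1 / 2) ^ k - (1 / 2) ^ (2 * k + 3) with ha
  have ha0 : 0 < a := lt_trans (by norm_num) (one_sub_pow_pos hk)
  have ha1 : a ≤ 1 := by
    have h1 : (0 : ℝ) < (1 / 2) ^ k := by positivity
    have h2 : (0 : ℝ) < (1 / 2) ^ (2 * k + 3) := by positivity
    linarith
  set c : ℝ := ((1 / 2) ^ (2 * k + 3)) ^ s with hc
  have hc0 : 0 < c := by positivity
  have hcard : (Fintype.card ((Fin k → Fin n) × (Fin k → Fin n) × Fin n × Fin n) : ℝ) =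
      (n : ℝ) ^ (2 * k + 2) := by
    simp
    ring
  rw [← hcard, ← le_div_iff₀ hc0, mul_div_assoc]
  refine randomGraph_real_exists_le n _
    (fun (i : (Fin k → Fin n) × (Fin k → Fin n) × Fin n × Fin n) G =>
    (#(univ.image i.1) = k ∧ ¬ univ.image i.1 ⊆ univ.image i.2.1 ∧ (∀ j, i.2.1 j ≠ i.2.2.1) ∧
      ∀ j, i.2.1 j ≠ i.2.2.2) ∧
    #{u ∈ (univ.image i.1 ∪ univ.image i.2.1 ∪ {i.2.2.1, i.2.2.2})ᶜ |
      ∀ a ∈ univ.image i.1, ¬ G.Adj a u} ≤ s ∧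
    ∀ u ∈ (univ.image i.1 ∪ univ.image i.2.1 ∪ {i.2.2.1, i.2.2.2})ᶜ,
      G.Adj i.2.2.1 u → G.Adj i.2.2.2 u → ∃ j, G.Adj (i.2.1 j) u) _ ?_ ?_
  · rintro G ⟨hG, hmin, hmax⟩
    obtain ⟨S, hS, hSmin⟩ := exists_ncard_undominated_eq (G := G) hkn.le
    obtain ⟨t, rfl⟩ : ∃ t : Fin k → Fin n, univ.image t = S := by
      refine ⟨S.orderEmbOfFin hS, ?_⟩
      rw [← Finset.coe_inj]
      simp
    have hD : (undominated G (univ.image t)).Nonempty := by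
      rw [← Set.ncard_pos (Set.toFinite _)]
      omega
    obtain ⟨v, w, C, hSC, hv, hw, htrap⟩ :=
      exists_trap_of_copsWin_of_undominated hG.copsWin _ hS hD fun C => by
        by_contra! hcon
        have := Fintype.card_le_of_surjective C hcon
        simp at this
        omega
    refine ⟨(t, C, v, w), ⟨hS, hSC, hv, hw⟩, ?_, ?_⟩
    · refine le_trans ?_ (hSmin.trans_le hmax)
      rw [← Set.ncard_coe_finset]
      refine Set.ncard_le_ncard ?_ (Set.toFinite _)
      intro u hu
      simp only [Finset.coe_filter, Set.mem_ofPred_eq] at hu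
      rw [mem_undominated]
      rintro a ha (rfl | hau)
      · apply Finset.mem_compl.1 hu.1
        simp only [Finset.mem_union]
        exact Or.inl (Or.inl ha)
      · exact hu.2 a ha hau
    · intro u hu hvu hwu
      obtain ⟨j, rfl | hj⟩ := htrap u hvu hwu
      · exact absurd hu (by simp)
      · exact ⟨j, hj⟩
  · rintro ⟨t, C, v, w⟩
    dsimp only
    by_cases hf : #(univ.image t) = k ∧ ¬ univ.image t ⊆ univ.image C ∧ (∀ j, C j ≠ v) ∧
      ∀ j, C j ≠ w
    · obtain ⟨hS, hSC, hv, hw⟩ := hf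
      have h := randomGraph_real_nearlyDominating_le _ hS C v w hSC hv hw s
      simp only [hS, hSC, hv, hw, ne_eq, not_false_eq_true, implies_true, true_and, and_self]
      rw [le_div_iff₀ hc0]
      refine h.trans (pow_le_pow_of_le_one ha0.le ha1 ?_)
      have h1 : #(univ.image C) ≤ k := Finset.card_image_le.trans (by simp)
      have h2 : #({v, w} : Finset (Fin n)) ≤ 2 := Finset.card_le_two
      have h3 := Finset.card_union_le (univ.image t ∪ univ.image C) {v, w}
      have h4 := Finset.card_union_le (univ.image t) (univ.image C)
      rw [Finset.card_compl, Fintype.card_fin]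
      omega
    · simp only [hf, false_and, Set.ofPred_false, MeasureTheory.measureReal_empty]
      positivity

end Bounds

lemma eventually_const_mul_pow_mul_pow_le {r q : ℝ} (hr : 0 ≤ r) (hrq : r < q) (A : ℝ) (d : ℕ) :
    ∀ᶠ n : ℕ in Filter.atTop, A * n ^ d * r ^ n ≤ q ^ n := by
  have hq : 0 < q := hr.trans_lt hrq
  have h := (tendsto_pow_const_mul_const_pow_of_lt_one d (div_nonneg hr hq.le)
    ((div_lt_one hq).2 hrq)).const_mul A
  rw [mul_zero] at h
  filter_upwards [h.eventually_le_const one_pos] with n hn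
  rw [div_pow, ← mul_assoc, ← mul_div_assoc, div_le_one (by positivity)] at hn
  exact hn

end CopsAndRobbers

open CopsAndRobbers in
theorem theorem3 (k : ℕ) (hk : 1 ≤ k) :
    ∃ ξ : ℝ, 0 < ξ ∧ ∃ ε : ℝ, 0 < ε ∧ ∀ᶠ n : ℕ in Filter.atTop,
      (CopsAndRobbers.randomGraph n).real
          {G | CopsAndRobbers.IsCopWin G k ∧ 1 ≤ CopsAndRobbers.minUndominated G k ∧
            (CopsAndRobbers.minUndominated G k : ℝ) ≤ ξ * n}
        ≤ (2 : ℝ) ^ ((Real.logb 2 (1 - (2 : ℝ) ^ (-(k : ℝ))) - ε) * n) ∧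
      (CopsAndRobbers.randomGraph n).real
          {G | CopsAndRobbers.IsCopWin G k ∧
            ξ * n < (CopsAndRobbers.minUndominated G k : ℝ)}
        ≤ (2 : ℝ) ^ ((Real.logb 2 (1 - (2 : ℝ) ^ (-(k : ℝ))) - ε) * n) := by
  have hpow : (2 : ℝ) ^ (-(k : ℝ)) = (1 / 2) ^ k := by
    rw [Real.rpow_neg (by norm_num), Real.rpow_natCast, one_div, inv_pow]
  rw [hpow]
  set b : ℝ := (1 / 2) ^ (2 * k + 3) with hb
  set c : ℝ := 1 - (1 / 2) ^ k with hc
  have hb0 : 0 < b := by positivity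
  have hb1 : b < 1 := pow_lt_one₀ (by norm_num) (by norm_num) (by omega)
  have ha : 1 / 4 < c - b := one_sub_pow_pos hk
  -- The gap is split as `c - b < r < q < c`: `ξ` uses up the step to `r`, polynomial factors the
  -- step to `q`, and `ε` is the rest.
  obtain ⟨r, har, hrc⟩ := exists_between (show c - b < c by linarith)
  obtain ⟨q, hrq, hqc⟩ := exists_between hrc
  have ha0 : 0 < c - b := by linarith
  have hr0 : 0 < r := by linarith
  have hq0 : 0 < q := by linarith
  -- Chosen so that dividing by the Markov factor `b ^ (ξ * n)` turns `(c - b) ^ n` into `r ^ n`.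
  set ξ : ℝ := Real.logb b ((c - b) / r) with hξ
  have hξ0 : 0 < ξ := Real.logb_pos_of_base_lt_one hb0 hb1 (by positivity)
    ((div_lt_one hr0).2 har)
  have hbξ : b ^ ξ = (c - b) / r := Real.rpow_logb hb0 hb1.ne (by positivity)
  obtain ⟨T, hT⟩ := exists_nat_ge (2 / ξ)
  rw [div_le_iff₀ hξ0] at hT
  refine ⟨ξ, hξ0, Real.logb 2 c - Real.logb 2 q,
    sub_pos.2 (Real.logb_lt_logb (by norm_num) hq0 hqc), ?_⟩
  have hlim : Filter.Tendsto (fun n : ℕ => ξ * n) Filter.atTop Filter.atTop :=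
    tendsto_natCast_atTop_atTop.const_mul_atTop hξ0
  filter_upwards [Filter.eventually_gt_atTop (2 * k + 2),
    hlim.eventually_gt_atTop (((k + 1) * T : ℕ) : ℝ),
    eventually_const_mul_pow_mul_pow_le hr0.le hrq (1 / (c - b) ^ (2 * k + 2)) (2 * k + 2),
    eventually_const_mul_pow_mul_pow_le (by norm_num) (ha.trans (har.trans hrq))
      (2 ^ ((k + 1) * T * T)) ((k + 1) * T)] with n hn hnT h₁ h₂
  have hR : (2 : ℝ) ^ ((Real.logb 2 c - (Real.logb 2 c - Real.logb 2 q)) * n) = q ^ n := by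
    rw [sub_sub_cancel, Real.rpow_mul (by norm_num), Real.rpow_logb (by norm_num) (by norm_num) hq0,
      Real.rpow_natCast]
  rw [hR]
  constructor
  · refine le_trans ?_ h₁
    have h := randomGraph_real_undominated_le_le (n := n) hk (by omega) ⌊ξ * n⌋₊
    have hset : {G : SimpleGraph (Fin n) | IsCopWin G k ∧ 1 ≤ minUndominated G k ∧
        (minUndominated G k : ℝ) ≤ ξ * n} =
        {G | IsCopWin G k ∧ 1 ≤ minUndominated G k ∧ minUndominated G k ≤ ⌊ξ * n⌋₊} := by
      ext G
      simp only [Set.mem_ofPred_eq, Nat.le_floor_iff (show (0 : ℝ) ≤ ξ * n by positivity)]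
    rw [hset]
    have hs : ((c - b) / r) ^ n ≤ b ^ ⌊ξ * n⌋₊ := by
      rw [← hbξ, ← Real.rpow_natCast, ← Real.rpow_mul hb0.le, ← Real.rpow_natCast]
      exact Real.rpow_le_rpow_of_exponent_ge hb0 hb1.le (Nat.floor_le (by positivity))
    have h3 := (mul_le_mul_of_nonneg_left hs MeasureTheory.measureReal_nonneg).trans h
    rw [← le_div_iff₀ (by positivity)] at h3
    refine h3.trans_eq ?_
    rw [pow_sub₀ _ ha0.ne' (by omega), div_pow]
    field_simp
  · refine le_trans ?_ h₂
    have hceil : (k + 1) * T < ⌈ξ * n⌉₊ := Nat.lt_ceil.2 hnT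
    obtain ⟨s, hs⟩ := Nat.exists_eq_add_of_lt hceil
    have h := randomGraph_real_undominated_ge_le (n := n) (k := k) (by omega) (by omega) T (s + 1)
      (by omega)
    have hsub : {G : SimpleGraph (Fin n) | IsCopWin G k ∧ ξ * n < (minUndominated G k : ℝ)} ⊆
        {G | IsCopWin G k ∧ s + 1 + (k + 1) * T ≤ minUndominated G k} := by
      rintro G ⟨hG, hmin⟩
      refine ⟨hG, ?_⟩
      have := Nat.ceil_le.2 hmin.le
      omega
    refine (MeasureTheory.measureReal_mono hsub).trans (h.trans ?_)
    -- Since `T * ξ ≥ 2`, the traps give `4 ^ (-n)` up to a constant, and `1 / 4 < q` leaves room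
    -- for the polynomial factor.
    have hexp : 2 * n ≤ (s + 1) * T + (k + 1) * T * T := by
      have h4 : ξ * n ≤ ((s + 1 + (k + 1) * T : ℕ) : ℝ) :=
        (Nat.le_ceil _).trans (by rw [hs]; apply le_of_eq; congr 1; ring)
      have h5 : (2 * n : ℝ) ≤ ((s + 1 + (k + 1) * T : ℕ) : ℝ) * T := by
        calc (2 * n : ℝ) ≤ T * ξ * n := by gcongr
          _ = ξ * n * T := by ring
          _ ≤ _ := by gcongr
      rw [← add_mul]
      exact_mod_cast h5
    have h6 : ((1 : ℝ) / 2) ^ ((s + 1) * T) ≤ 2 ^ ((k + 1) * T * T) * (1 / 4) ^ n := by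
      have h7 : ((1 : ℝ) / 2) ^ ((s + 1) * T + (k + 1) * T * T) ≤ (1 / 2) ^ (2 * n) :=
        pow_le_pow_of_le_one (by norm_num) (by norm_num) hexp
      rw [pow_add, pow_mul (1 / 2 : ℝ) 2 n] at h7
      norm_num only [] at h7
      rw [one_div, inv_pow, inv_pow, ← div_eq_mul_inv, div_le_iff₀ (by positivity)] at h7
      rw [one_div, inv_pow, mul_comm (2 ^ _)]
      exact h7
    calc ((n : ℝ) ^ (k + 1)) ^ T * (1 / 2) ^ ((s + 1) * T)
        ≤ ((n : ℝ) ^ (k + 1)) ^ T * (2 ^ ((k + 1) * T * T) * (1 / 4) ^ n) := by gcongr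
      _ = _ := by rw [← pow_mul]; ring
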